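/- Let $\mathbb{F}$ be an arbitrary field, let $\alpha \in \mathbb{F} \setminus \{0\}$, and let $n$ be a non-negative integer. Then, for every matrix $A \in \mathrm{M}_n(\mathbb{F})$, there exist scalars $\beta, \gamma \in \mathbb{F}$ and idempotent matrices $P, Q, R \in \mathrm{M}_{2n}(\mathbb{F})$ such that $$A \oplus \alpha I_n = \alpha P + \beta Q + \gamma R,$$ where $A \oplus \alpha I_n$ denotes the block-diagonal matrix $\begin{bmatrix} A & 0 \\ 0 & \alpha I_n \end{bmatrix} \in \mathrm{M}_{2n}(\mathbb{F})$. In other words, $A \oplus \alpha I_n$ is an $(\alpha,\beta,\gamma)$-composite, where a square matrix $M \in \mathrm{M}_m(\mathbb{F})$ is called an $(\alpha_1,\dots,\alpha_k)$-composite, for scalars $\alpha_1,\dots,\alpha_k \in \mathbb{F}$, when there are idempotent matrices $P_1,\dots,P_k \in \mathrm{M}_m(\mathbb{F})$ such that $M=\sum_{i=1}^k \alpha_i P_i$. -/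

import Mathlib

/-- Given scalars `α₁, …, α_k`, a square matrix `M` is an `(α₁, …, α_k)`-composite when
`M = α₁ P₁ + ⋯ + α_k P_k` for some idempotent matrices `P₁, …, P_k` of the same size as `M`. -/
def IsComposite {F ι : Type*} [Field F] [Fintype ι] {k : ℕ}
    (α : Fin k → F) (M : Matrix ι ι F) : Prop :=
  ∃ P : Fin k → Matrix ι ι F, (∀ i, IsIdempotentElem (P i)) ∧ M = ∑ i, α i • P i

section

open Module

/-! Subtracting `α` leaves `B ⊕ 0` with `B = A - α`. Writing `B = G H` through its range reduces
this to `[C, 0; 1, 0]`, `C = H G`; since `1 - P` is idempotent with `P`, a summand `-α P` suffices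
there. Split `C + α = X + Y` with `Y` nilpotent and `X` annihilated by `x ^ N * (x - t)`. Then `[X,
0; 1, Y]` is nilpotent or a nilpotent map plus a nonzero scalar one, hence a multiple of a
difference of idempotents, and a shear conjugates it to `[C, *; 1, α]`, whose second column supplies
`α P`. -/

theorem Submodule.exists_between_disjoint_sup_eq {F V : Type*} [DivisionRing F] [AddCommGroup V]
    [Module F V]
    {a b k : Submodule F V} (hab : Disjoint a b) (ha : a ≤ k) (hb : b ≤ k) :
    ∃ c, a ≤ c ∧ c ≤ k ∧ Disjoint c b ∧ c ⊔ b = k := by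
  obtain ⟨c, hc, hcb⟩ := hab.exists_isCompl
  refine ⟨c ⊓ k, le_inf hc ha, inf_le_right, hcb.disjoint.mono_left inf_le_left, ?_⟩
  rw [inf_comm, inf_sup_assoc_of_le _ hb, hcb.sup_eq_top, inf_top_eq]

/-- An invariant subspace on which `f` is nilpotent has a `ℤ/2`-grading for which `f` is odd. -/
theorem LinearMap.exists_odd_grading {F V : Type*} [Field F] [AddCommGroup V] [Module F V]
    (f : End F V) (N : ℕ) (K : Submodule F V) (hK : K.map f ≤ K) (hN : ∀ x ∈ K, (f ^ N) x = 0) :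
    ∃ I J : Submodule F V, Disjoint I J ∧ I ⊔ J = K ∧ I.map f ≤ J ∧ J.map f ≤ I := by
  induction N generalizing K with
  | zero =>
    have : K = ⊥ := by
      rw [Submodule.eq_bot_iff]
      simpa using hN
    exact ⟨⊥, ⊥, by simp [this]⟩
  | succ N ih =>
    obtain ⟨I, J, hd, hs, hIJ, hJI⟩ := ih (K.map f) (Submodule.map_mono hK) (by
      rintro _ ⟨x, hx, rfl⟩
      simpa [pow_succ] using hN x hx)
    have hI : I ≤ K := (le_sup_left.trans hs.le).trans hK
    have hJ : J ≤ K := (le_sup_right.trans hs.le).trans hK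
    -- The grading of `f(K)` is enlarged inside `f⁻¹(J) ∩ K` and `f⁻¹(I) ∩ K`, which together span
    -- `K`; the removed overlaps keep the two new parts disjoint.
    obtain ⟨V₀, h1, h2, h3, h4⟩ := Submodule.exists_between_disjoint_sup_eq
      (a := I) (b := J ⊓ J.comap f) (k := J.comap f ⊓ K) (hd.mono_right inf_le_left)
      (le_inf (Submodule.map_le_iff_le_comap.1 hIJ) hI) (le_inf inf_le_right (inf_le_left.trans hJ))
    have hVJ : Disjoint V₀ J := by
      rw [disjoint_iff_inf_le]
      exact (le_inf inf_le_left (le_inf inf_le_right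
        (inf_le_left.trans (h2.trans inf_le_left)))).trans h3.le_bot
    obtain ⟨V₁, g1, g2, g3, g4⟩ := Submodule.exists_between_disjoint_sup_eq
      (a := J) (b := V₀ ⊓ I.comap f) (k := I.comap f ⊓ K) (hVJ.symm.mono_right inf_le_left)
      (le_inf (Submodule.map_le_iff_le_comap.1 hJI) hJ)
      (le_inf inf_le_right (inf_le_left.trans (h2.trans inf_le_right)))
    refine ⟨V₀, V₁, ?_, le_antisymm (sup_le (h2.trans inf_le_right) (g2.trans inf_le_right)) ?_,
      ?_, ?_⟩
    · rw [disjoint_iff_inf_le]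
      exact (le_inf inf_le_right (le_inf inf_le_left
        (inf_le_right.trans (g2.trans inf_le_left)))).trans g3.le_bot
    · have hA : J.comap f ⊓ K ≤ V₀ ⊔ V₁ := by
        rw [← h4]
        exact sup_le_sup le_rfl (inf_le_left.trans g1)
      have hB : I.comap f ⊓ K ≤ V₀ ⊔ V₁ := by
        rw [← g4, sup_comm V₀]
        exact sup_le_sup le_rfl inf_le_left
      intro x hx
      obtain ⟨a, ha, b, hb, hab⟩ := Submodule.mem_sup.1
        (hs.ge (Submodule.mem_map_of_mem hx) : f x ∈ I ⊔ J)
      obtain ⟨k, hk, rfl⟩ := hs.le (Submodule.mem_sup_left ha)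
      have : x = (x - k) + k := by abel
      rw [this]
      refine add_mem (hA ⟨?_, sub_mem hx hk⟩) (hB ⟨ha, hk⟩)
      simpa [← hab] using hb
    · exact (Submodule.map_le_iff_le_comap.2 (h2.trans inf_le_left)).trans g1
    · exact (Submodule.map_le_iff_le_comap.2 (g2.trans inf_le_left)).trans h1

/-- If `f` is the direct sum of `b • id` and a nilpotent map, where `b ≠ 0`, then `f` is `b` times
a difference of two idempotents. -/
theorem LinearMap.eq_smul_sub_of_sub_mul_pow_eq_zero {F V : Type*} [Field F] [AddCommGroup V]
    [Module F V] (f : End F V) (N : ℕ) {b : F} (hb : b ≠ 0) (h : f * f ^ N = b • f ^ N) :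
    ∃ Q R : End F V, IsIdempotentElem Q ∧ IsIdempotentElem R ∧ f = b • (Q - R) := by
  -- `E` is the projection onto the `b`-eigenspace along `ker (f ^ N)`.
  obtain ⟨E, hE⟩ : ∃ E : End F V, E = (b ^ N)⁻¹ • f ^ N := ⟨_, rfl⟩
  have hbN : b ^ N ≠ 0 := pow_ne_zero _ hb
  have hfN : f ^ N = b ^ N • E := by rw [hE, smul_inv_smul₀ hbN]
  have hfE : f * E = b • E := by rw [hE, mul_smul_comm, h, smul_comm]
  have hEf : E * f = b • E := by
    rw [← hfE, hE, mul_smul_comm, smul_mul_assoc, ← pow_succ, ← pow_succ']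
  have hk : ∀ k, f ^ k * E = b ^ k • E := by
    intro k
    induction k with
    | zero => simp
    | succ k ih => rw [pow_succ, mul_assoc, hfE, mul_smul_comm, ih, smul_smul, pow_succ']
  have hEE : E * E = E := by
    conv_lhs => enter [1]; rw [hE]
    rw [smul_mul_assoc, hk, inv_smul_smul₀ hbN]
  obtain ⟨I, J, hd, hs, hIJ, hJI⟩ := LinearMap.exists_odd_grading f N (LinearMap.ker E) (by
      rintro _ ⟨x, hx, rfl⟩
      have : E (f x) = b • E x := by simpa using LinearMap.congr_fun hEf x
      simp [this, LinearMap.mem_ker.1 hx]) (by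
      intro x hx
      simpa [hfN] using Or.inr hx)
  have hIE : ∀ x ∈ I, E x = 0 := fun x hx => hs.le (Submodule.mem_sup_left hx)
  have hJE : ∀ x ∈ J, E x = 0 := fun x hx => hs.le (Submodule.mem_sup_right hx)
  have hEker : ∀ x, x - E x ∈ LinearMap.ker E := by
    intro x
    have : E (E x) = E x := LinearMap.congr_fun hEE x
    simp [this]
  have hc : IsCompl I (J ⊔ LinearMap.range E) := by
    constructor
    · rw [Submodule.disjoint_def]
      intro x hx hx'
      obtain ⟨j, hj, _, ⟨y, rfl⟩, rfl⟩ := Submodule.mem_sup.1 hx'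
      have h1 := hIE _ hx
      have : E (E y) = E y := LinearMap.congr_fun hEE y
      rw [map_add, hJE j hj, this, zero_add] at h1
      rw [h1, add_zero] at hx ⊢
      exact Submodule.disjoint_def.1 hd _ hx hj
    · rw [codisjoint_iff, ← sup_assoc, hs, eq_top_iff]
      intro x _
      rw [← sub_add_cancel x (E x)]
      exact Submodule.add_mem_sup (hEker x) ⟨x, rfl⟩
  obtain ⟨p, hp⟩ : ∃ p : End F V, p = I.projection _ hc := ⟨_, rfl⟩
  have hpmem : ∀ x, p x ∈ I := fun x => by rw [hp]; exact Submodule.projection_apply_mem hc x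
  have hpI : ∀ x ∈ I, p x = x := fun x hx => by
    rw [hp]; exact Submodule.projection_apply_of_mem_left hc hx
  have hp0 : ∀ x ∈ J ⊔ LinearMap.range E, p x = 0 := fun x hx => by
    rw [hp]; exact (Submodule.projection_apply_eq_zero_iff hc).2 hx
  have hpE : ∀ x, p (E x) = 0 := fun x => hp0 _ (Submodule.mem_sup_right ⟨x, rfl⟩)
  have hEp : ∀ x, E (p x) = 0 := fun x => hIE _ (hpmem x)
  have hpp : ∀ x, p (p x) = p x := fun x => hpI _ (hpmem x)
  have hE2 : ∀ x, E (E x) = E x := LinearMap.congr_fun hEE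
  have hq : ∀ x, x - E x - p x ∈ J := by
    intro x
    obtain ⟨i, hi, j, hj, hij⟩ := Submodule.mem_sup.1 (hs.ge (hEker x))
    have : p (x - E x) = i := by rw [← hij, map_add, hpI i hi, hp0 j (Submodule.mem_sup_left hj), add_zero]
    rw [map_sub, hpE, sub_zero] at this
    rw [this, ← hij, add_sub_cancel_left]
    exact hj
  have hfp : ∀ x, f (p x) ∈ J := fun x => hIJ (Submodule.mem_map_of_mem (hpmem x))
  have hfq : ∀ x, f (x - E x - p x) ∈ I := fun x => hJI (Submodule.mem_map_of_mem (hq x))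
  -- On `I ⊕ J` these are block triangular with diagonal `(1, 0)`: each takes one of the two
  -- off-diagonal blocks of the odd map `f`.
  refine ⟨E + p + b⁻¹ • (f * (1 - E - p)), p - b⁻¹ • (f * p), ?_, ?_, ?_⟩
  · refine LinearMap.ext fun x => ?_
    have e1 := hIE _ (hfq x)
    have e2 := hpI _ (hfq x)
    simp only [End.mul_apply, LinearMap.add_apply, LinearMap.smul_apply, LinearMap.sub_apply,
      End.one_apply, map_add, map_smul, hE2, hpE, hEp, hpp, e1, e2]
    simp
  · refine LinearMap.ext fun x => ?_
    have e2 := hp0 _ (Submodule.mem_sup_left (hfp x))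
    simp [hpp, e2]
  · rw [show E + p + b⁻¹ • (f * (1 - E - p)) - (p - b⁻¹ • (f * p)) =
      E + b⁻¹ • (f - f * E) by
        rw [mul_sub, mul_sub, mul_one, smul_sub, smul_sub]; abel, hfE, smul_sub,
      inv_smul_smul₀ hb, add_sub_cancel, smul_inv_smul₀ hb]

/-- Every endomorphism `A` is the sum of an `X` annihilated by `x ^ N * (x - t)` and a nilpotent `Y`. -/
theorem Module.End.exists_add_nilpotent {F : Type*} [Field F] (n : ℕ) :
    ∀ (V : Type*) [AddCommGroup V] [Module F V] [FiniteDimensional F V], finrank F V = n →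
    ∀ A : End F V, ∃ (t : F) (N : ℕ) (X Y : End F V),
      A = X + Y ∧ X * X ^ N = t • X ^ N ∧ Y ^ N = 0 := by
  induction n with
  | zero =>
    intro V _ _ _ hV A
    have := finrank_zero_iff.1 hV
    exact ⟨0, 0, 0, 0, Subsingleton.elim _ _, Subsingleton.elim _ _, Subsingleton.elim _ _⟩
  | succ n ih =>
    intro V _ _ _ hV A
    by_cases hA : ∃ t : F, A = t • LinearMap.id
    · obtain ⟨t, rfl⟩ := hA
      exact ⟨t, 1, t • 1, 0, by simp; rfl, by simp, by simp⟩
    obtain ⟨v, hv⟩ : ∃ v, v ∉ Submodule.span F {A v} := by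
      by_contra! h
      refine hA (LinearMap.exists_eq_smul_id_of_forall_notLinearIndependent fun v hv => ?_)
      obtain ⟨c, hc⟩ := Submodule.mem_span_singleton.1 (h v)
      have := (LinearIndependent.pair_iff.1 hv 1 (-c) (by simp [hc])).1
      exact one_ne_zero this
    -- Along `F v ⊕ ker φ`, `A` has zero corner entry. So `X` below can take the top row and `Y` the
    -- first column, each with zero at the corner.
    obtain ⟨φ, hφv, hφ⟩ : ∃ φ : Dual F V, φ v = 1 ∧ φ (A v) = 0 := by
      obtain ⟨ψ, h1, h2⟩ := Submodule.exists_le_ker_of_notMem hv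
      refine ⟨(ψ v)⁻¹ • ψ, by simp [h1], ?_⟩
      have : ψ (A v) = 0 := h2 (Submodule.mem_span_singleton_self _)
      simp [this]
    let W := LinearMap.ker φ
    let q : V →ₗ[F] W := (LinearMap.id - φ.smulRight v).codRestrict W (by
      intro x
      simp [W, hφv])
    have hq : ∀ x, (q x : V) = x - φ x • v := fun x => rfl
    have hqv : q v = 0 := Subtype.ext (by simp [hq, hφv])
    have hqW : ∀ w : W, q w = w := fun w => Subtype.ext (by simp [hq, LinearMap.mem_ker.1 w.2])
    have hW : finrank F W = n := by
      have h1 := φ.finrank_range_add_finrank_ker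
      have h2 : LinearMap.range φ = ⊤ := LinearMap.range_eq_top.2
        (LinearMap.surjective_of_ne_zero (fun h => by simp [h] at hφv))
      rw [h2, finrank_top, finrank_self] at h1
      change finrank F (LinearMap.ker φ) = n
      omega
    obtain ⟨t, N, X', Y', hXY, hX, hY⟩ := ih W hW (q ∘ₗ A ∘ₗ W.subtype)
    let w : W := ⟨A v, hφ⟩
    let X : End F V := W.subtype ∘ₗ X' ∘ₗ q + (φ ∘ₗ A ∘ₗ W.subtype ∘ₗ q).smulRight v
    let Y : End F V := W.subtype ∘ₗ (Y' ∘ₗ q + φ.smulRight w)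
    have hXv : X v = 0 := by simp [X, hqv]
    have hqX : ∀ k x, q ((X ^ k) x) = (X' ^ k) (q x) := by
      intro k
      induction k with
      | zero => simp
      | succ k ih =>
        intro x
        have : q (X x) = X' (q x) := by simp [X, hqv, hqW]
        rw [pow_succ, End.mul_apply, ih, this, pow_succ, End.mul_apply]
    have hYW : ∀ k (u : W), (Y ^ k) u = (Y' ^ k) u := by
      intro k
      induction k with
      | zero => simp
      | succ k ih =>
        intro u
        have : Y u = (Y' u : W) := by
          simp [Y, hqW, LinearMap.mem_ker.1 u.2]
        rw [pow_succ, End.mul_apply, this, ih, pow_succ, End.mul_apply]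
    refine ⟨t, N + 1, X, Y, ?_, ?_, ?_⟩
    · refine LinearMap.ext fun x => ?_
      have h1 := congrArg Subtype.val (LinearMap.congr_fun hXY (q x))
      have h2 : A (q x) = A x - φ x • A v := by rw [hq, map_sub, map_smul]
      simp only [LinearMap.comp_apply, LinearMap.add_apply, Submodule.subtype_apply, hq,
        Submodule.coe_add] at h1
      simp only [X, Y, w, LinearMap.add_apply, LinearMap.comp_apply, Submodule.subtype_apply,
        LinearMap.smulRight_apply, Submodule.coe_add, Submodule.coe_smul, hq]
      rw [hq] at h2
      rw [h2] at h1 ⊢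
      linear_combination (norm := module) h1
    · refine LinearMap.ext fun x => ?_
      have h1 : q ((X ^ (N + 1)) x - t • (X ^ N) x) = 0 := by
        rw [map_sub, map_smul, hqX, hqX, pow_succ', hX]
        simp
      have h2 : (X ^ (N + 1)) x - t • (X ^ N) x = φ ((X ^ (N + 1)) x - t • (X ^ N) x) • v :=
        sub_eq_zero.1 (by rw [← hq, h1]; rfl)
      have h3 : X ((X ^ (N + 1)) x - t • (X ^ N) x) = 0 := by rw [h2, map_smul, hXv, smul_zero]
      rw [map_sub, map_smul, sub_eq_zero] at h3
      simpa [pow_succ' X N] using h3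
    · refine LinearMap.ext fun x => ?_
      have : Y x = (Y' (q x) + φ x • w : W) := rfl
      rw [pow_succ, End.mul_apply, this, hYW, hY]
      rfl

/-- The block matrix `[X, 0; 1, Y]` is a multiple of a difference of two idempotents. -/
theorem Module.End.exists_eq_smul_sub_of_add {F V : Type*} [Field F] [AddCommGroup V]
    [Module F V] (t : F) (N : ℕ) (X Y : End F V) (hX : X * X ^ N = t • X ^ N) (hY : Y ^ N = 0) :
    ∃ (b : F) (Q R : End F (V × V)), IsIdempotentElem Q ∧ IsIdempotentElem R ∧
      (X ∘ₗ LinearMap.fst F V V).prod (LinearMap.fst F V V + Y ∘ₗ LinearMap.snd F V V) =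
        b • (Q - R) := by
  obtain ⟨M, hM⟩ : ∃ M : End F (V × V), M = (X ∘ₗ LinearMap.fst F V V).prod
    (LinearMap.fst F V V + Y ∘ₗ LinearMap.snd F V V) := ⟨_, rfl⟩
  rw [← hM]
  have hfst : ∀ k z, ((M ^ k) z).1 = (X ^ k) z.1 := by
    intro k
    induction k with
    | zero => simp
    | succ k ih =>
      intro z
      rw [pow_succ, End.mul_apply, ih, pow_succ, End.mul_apply, hM]
      rfl
  have hsnd : ∀ k y, (M ^ k) (0, y) = (0, (Y ^ k) y) := by
    intro k
    induction k with
    | zero => simp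
    | succ k ih =>
      intro y
      have : M (0, y) = (0, Y y) := by simp [hM]
      rw [pow_succ, End.mul_apply, this, ih, pow_succ, End.mul_apply]
  -- The first `N` powers push the image of `M - t` into `0 × V`; the other `N` kill it there, as
  -- `M` acts by `Y`.
  have h : M * M ^ (N + N) = t • M ^ (N + N) := by
    refine LinearMap.ext fun z => ?_
    have h1 : ((M ^ (N + 1)) z - t • (M ^ N) z).1 = 0 := by
      rw [Prod.fst_sub, Prod.smul_fst, hfst, hfst, pow_succ', hX]
      simp
    have h2 := hsnd N ((M ^ (N + 1)) z - t • (M ^ N) z).2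
    rw [← h1, Prod.mk.eta, map_sub, map_smul, hY, h1, LinearMap.zero_apply, Prod.mk_zero_zero,
      sub_eq_zero, ← End.mul_apply, ← End.mul_apply, ← pow_add, ← pow_add, ← add_assoc,
      pow_succ'] at h2
    exact h2
  by_cases ht : t = 0
  · obtain ⟨Q, R, hQ, hR, hQR⟩ := LinearMap.eq_smul_sub_of_sub_mul_pow_eq_zero M (N + N + 1)
      (one_ne_zero (α := F)) (by rw [pow_succ', h, ht]; simp)
    exact ⟨1, Q, R, hQ, hR, hQR⟩
  · obtain ⟨Q, R, hQ, hR, hQR⟩ := LinearMap.eq_smul_sub_of_sub_mul_pow_eq_zero M _ ht h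
    exact ⟨t, Q, R, hQ, hR, hQR⟩

theorem IsIdempotentElem.conj_linearMap {F V W : Type*} [Field F] [AddCommGroup V] [Module F V]
    [AddCommGroup W] [Module F W] {P : End F V} (hP : IsIdempotentElem P) (i : V →ₗ[F] W)
    (p : W →ₗ[F] V) (h : p ∘ₗ i = LinearMap.id) :
    IsIdempotentElem (i ∘ₗ P ∘ₗ p : End F W) := by
  refine LinearMap.ext fun x => ?_
  have h1 : ∀ y, p (i y) = y := LinearMap.congr_fun h
  have h2 : ∀ y, P (P y) = P y := LinearMap.congr_fun hP
  simp [h1, h2]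

/-- The block matrix `[C, 0; 1, 0]` is an `(-a, b, -b)`-composite for some `b`. -/
theorem Module.End.exists_idempotents_of_prod {F V : Type*} [Field F] [AddCommGroup V]
    [Module F V] [FiniteDimensional F V] {a : F} (ha : a ≠ 0) (C : End F V) :
    ∃ (b : F) (P Q R : End F (V × V)), IsIdempotentElem P ∧ IsIdempotentElem Q ∧
      IsIdempotentElem R ∧
      (C ∘ₗ LinearMap.fst F V V).prod (LinearMap.fst F V V) = b • (Q - R) - a • P := by
  obtain ⟨t, N, X, Y, hC, hX, hY⟩ :=
    Module.End.exists_add_nilpotent _ V rfl (C + a • LinearMap.id)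
  obtain ⟨b, Q, R, hQ, hR, hM⟩ := Module.End.exists_eq_smul_sub_of_add t N X Y hX hY
  -- Chosen so that the sheared diagonal `(X + T, Y - T)` is `(C, a)`.
  let T : End F V := Y - a • LinearMap.id
  let S (T : End F V) : End F (V × V) :=
    (LinearMap.fst F V V + T ∘ₗ LinearMap.snd F V V).prod (LinearMap.snd F V V)
  have hS : S (-T) ∘ₗ S T = LinearMap.id := by
    refine LinearMap.ext fun z => ?_
    simp [S]
  refine ⟨b, (a⁻¹ • (T ∘ₗ Y - C ∘ₗ T) ∘ₗ LinearMap.snd F V V).prod (LinearMap.snd F V V),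
    S T ∘ₗ Q ∘ₗ S (-T), S T ∘ₗ R ∘ₗ S (-T), ?_, hQ.conj_linearMap _ _ hS,
    hR.conj_linearMap _ _ hS, ?_⟩
  · exact LinearMap.ext fun z => rfl
  · rw [← LinearMap.comp_sub, ← LinearMap.sub_comp, ← LinearMap.comp_smul, ← LinearMap.smul_comp,
      ← hM]
    have hCz : ∀ z, X z = C z + a • z - Y z := fun z => by
      have := LinearMap.congr_fun hC z
      simp only [LinearMap.add_apply, LinearMap.smul_apply, LinearMap.id_apply] at this
      rw [this, add_sub_cancel_right]
    refine LinearMap.ext fun z => Prod.ext ?_ ?_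
    · simp [S, T, hCz, smul_smul, mul_inv_cancel₀ ha]
      module
    · simp [S, T]
      abel

/-- The map `A ⊕ a • id` is an `(a, b, -b)`-composite for some `b`. The map `A ⊕ a • id - a • id` is
reduced to the shape `[C, 0; 1, 0]` by factoring `A - a • id` through its range. -/
theorem Module.End.exists_idempotents_prodMap {F U : Type*} [Field F] [AddCommGroup U]
    [Module F U] [FiniteDimensional F U] {a : F} (ha : a ≠ 0) (A : End F U) :
    ∃ (b : F) (P Q R : End F (U × U)), IsIdempotentElem P ∧ IsIdempotentElem Q ∧
      IsIdempotentElem R ∧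
      A.prodMap (a • LinearMap.id) = a • P + b • Q + (-b) • R := by
  let B : End F U := A - a • LinearMap.id
  let V := LinearMap.range B
  let G : V →ₗ[F] U := V.subtype
  let H : U →ₗ[F] V := B.rangeRestrict
  obtain ⟨G', hG⟩ := G.exists_leftInverse_of_injective V.ker_subtype
  obtain ⟨H', hH⟩ := H.exists_rightInverse_of_surjective B.range_rangeRestrict
  obtain ⟨b, P, Q, R, hP, hQ, hR, h⟩ := Module.End.exists_idempotents_of_prod ha (H ∘ₗ G)
  let p : U × U →ₗ[F] V × V :=
    (H ∘ₗ LinearMap.fst F U U).prod (G' ∘ₗ (LinearMap.fst F U U + LinearMap.snd F U U))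
  -- A section of `p`; the terms in `H' ∘ₗ H ∘ₗ G` cancel so that `i [C, 0; 1, 0] p = B ⊕ 0`.
  let i : V × V →ₗ[F] U × U :=
    LinearMap.coprod (H'.prod (-H')) ((G - H' ∘ₗ H ∘ₗ G).prod (H' ∘ₗ H ∘ₗ G))
  have hG' : ∀ x, G' (G x) = x := LinearMap.congr_fun hG
  have hH' : ∀ x, H (H' x) = x := LinearMap.congr_fun hH
  have hi : p ∘ₗ i = LinearMap.id := by
    refine LinearMap.ext fun z => Prod.ext ?_ ?_
    · simp [p, i, hH']
    · simp [p, i, hG']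
      abel
  have hGH : ∀ x, G (H x) = A x - a • x := fun x => rfl
  refine ⟨b, 1 - i ∘ₗ P ∘ₗ p, i ∘ₗ Q ∘ₗ p, i ∘ₗ R ∘ₗ p, (hP.conj_linearMap _ _ hi).one_sub,
    hQ.conj_linearMap _ _ hi, hR.conj_linearMap _ _ hi, ?_⟩
  have h1 : i ∘ₗ (b • (Q - R) - a • P) ∘ₗ p = A.prodMap (a • LinearMap.id) - a • LinearMap.id := by
    rw [← h]
    refine LinearMap.ext fun z => Prod.ext ?_ ?_
    · simp [p, i, hGH]
    · simp [p, i]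
  rw [sub_eq_iff_eq_add.1 h1.symm]
  refine LinearMap.ext fun z => ?_
  simp
  module

end

theorem mainTheorem5 {F : Type*} [Field F] (n : ℕ) (α : F) (hα : α ≠ 0)
    (A : Matrix (Fin n) (Fin n) F) :
    ∃ β γ : F, IsComposite ![α, β, γ]
      (Matrix.fromBlocks A 0 0 (α • (1 : Matrix (Fin n) (Fin n) F))) := by
  obtain ⟨b, P, Q, R, hP, hQ, hR, h⟩ :=
    Module.End.exists_idempotents_prodMap hα
      (Matrix.toLin (Pi.basisFun F (Fin n)) (Pi.basisFun F (Fin n)) A)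
  let v := Pi.basisFun F (Fin n)
  let e := LinearMap.toMatrixAlgEquiv (v.prod v)
  refine ⟨b, -b, ![e P, e Q, e R], ?_, ?_⟩
  · intro i
    fin_cases i
    · exact hP.map e
    · exact hQ.map e
    · exact hR.map e
  · have h1 := congrArg e h
    have h2 : e _ = _ := LinearMap.toMatrix_prodMap v v (Matrix.toLin v v A) (α • LinearMap.id)
    rw [h2] at h1
    simpa [Fin.sum_univ_three, LinearMap.toMatrix_toLin] using h1
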